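/- For positive integers $n \ge 2k$, let $\operatorname{SG}(n,k)$ denote the Schrijver graph: its vertices are the $k$-element subsets $S$ of $\{1,\dots,n\}$ that are $2$-stable, i.e. such that $2 \le |i-j| \le n-2$ for all distinct $i,j\in S$ (equivalently, $S$ contains no two consecutive elements of $\{1,\dots,n\}$, where $1$ and $n$ are also considered consecutive), and two vertices are adjacent if and only if they are disjoint as sets. Theorem. Let $n = 2k+r$ with integers $k > 2$ and $k-2 \le r \le 2k-3$. Then $\operatorname{SG}(n,k)$ is connected and its diameter (the maximum, over all pairs of vertices, of the length of a shortest path joining them) is exactly $3$. -/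

import Mathlib

/-- The vertices of the Kneser graph `KG(n, k)`: the `k`-element subsets of `{1, …, n}`. -/
abbrev KneserVertex (n k : ℕ) : Type :=
  {S : Finset ℕ // S ⊆ Finset.Icc 1 n ∧ S.card = k}

/-- The Kneser graph `KG(n, k)`: two distinct `k`-subsets of `{1, …, n}` are adjacent when they
are disjoint. (Distinctness is automatic for `k ≥ 1`.) -/
def kneserGraph (n k : ℕ) : SimpleGraph (KneserVertex n k) where
  Adj S T := S ≠ T ∧ Disjoint S.1 T.1
  symm := ⟨fun _ _ h => ⟨h.1.symm, h.2.symm⟩⟩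
  loopless := ⟨fun _ h => h.1 rfl⟩

/-- A set `S ⊆ {1, …, n}` is `s`-stable if any two distinct elements of it are at distance at
least `s` on the `n`-cycle, i.e. `s ≤ |i - j| ≤ n - s`. -/
def IsStable (s n : ℕ) (S : Finset ℕ) : Prop :=
  ∀ i ∈ S, ∀ j ∈ S, i ≠ j →
    (s : ℤ) ≤ |(i : ℤ) - (j : ℤ)| ∧ |(i : ℤ) - (j : ℤ)| ≤ (n : ℤ) - (s : ℤ)

/-- The Schrijver graph `SG(n, k)`: the subgraph of the Kneser graph `KG(n, k)` induced by the
`2`-stable `k`-subsets of `{1, …, n}`. -/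
def schrijverGraph (n k : ℕ) :
    SimpleGraph {S : KneserVertex n k | IsStable 2 n S.1} :=
  (kneserGraph n k).induce {S : KneserVertex n k | IsStable 2 n S.1}

/-! Let `A ≠ B` intersect. It suffices to find stable `C`, `D`, `E` with `C` avoiding `A`, `D`
avoiding `B`, `E` avoiding both, `C` and `D` disjoint, and `2|C| + |E|`, `2|D| + |E|` at least `n`.
If `|E| ≥ k`, then `E` contains a common neighbour; otherwise `|C|, |D| ≥ k`, and subsets of `C` and
`D` are the inner vertices of a path of length 3.

The sets are built by scanning the cycle from a shared point, with balances `2|C| + |E| - p` and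
`2|D| + |E| - p`. `D` can use a point of `A` only, `C` a point of `B` only; in free gaps `C` and `D`
alternate. The obstacle is a single free position between two shared points: it moves the balances
by `+1` and `-1`. A surplus of 1 on either side absorbs this. The first unshared point of the union
yields that surplus, so the scan must start where it precedes the next shared point (`exists_start`,
`exists_partial`).

For the lower bound, an explicit intersecting pair covers so much of the cycle that no stable
`k`-set avoids both. -/

/-! ### Extending partial solutions by one position -/

/-- A partial solution on the positions `1, …, p` of a cycle cut open at position `0`, for two sets
with indicators `a` and `b`: sets `C`, `D`, `E` without consecutive elements, where `C` avoids `a`,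
`D` avoids `b`, `E` avoids both, and `C` and `D` are disjoint. The Booleans `x y z` bound membership
of `p` in `C`, `D`, `E`; the integers `f g` bound `2 |C| + |E| - p` and `2 |D| + |E| - p`. -/
def Partial (a b : ℕ → Prop) (p : ℕ) (x y z : Bool) (f g : ℤ) : Prop :=
  ∃ C D E : Finset ℕ,
    (∀ i ∈ C, 0 < i ∧ i ≤ p ∧ ¬ a i ∧ i + 1 ∉ C) ∧
    (∀ i ∈ D, 0 < i ∧ i ≤ p ∧ ¬ b i ∧ i + 1 ∉ D) ∧
    (∀ i ∈ E, 0 < i ∧ i ≤ p ∧ ¬ a i ∧ ¬ b i ∧ i + 1 ∉ E) ∧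
    Disjoint C D ∧
    (p ∈ C → x = true) ∧ (p ∈ D → y = true) ∧ (p ∈ E → z = true) ∧
    f ≤ 2 * C.card + E.card - p ∧ g ≤ 2 * D.card + E.card - p

lemma Partial.zero (a b : ℕ → Prop) : Partial a b 0 false false false 0 0 :=
  ⟨∅, ∅, ∅, by simp⟩

lemma Partial.swap {a b : ℕ → Prop} {p : ℕ} {x y z : Bool} {f g : ℤ}
    (h : Partial a b p x y z f g) : Partial b a p y x z g f := by
  obtain ⟨C, D, E, hC, hD, hE, hCD, hx, hy, hz, hf, hg⟩ := h
  exact ⟨D, C, E, hD, hC, fun i hi => ⟨(hE i hi).1, (hE i hi).2.1, (hE i hi).2.2.2.1,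
    (hE i hi).2.2.1, (hE i hi).2.2.2.2⟩, hCD.symm, hy, hx, hz, hg, hf⟩

lemma exists_extend {S : Finset ℕ} {P : ℕ → Prop} {p : ℕ} {w : Bool} (w' : Bool)
    (hS : ∀ i ∈ S, 0 < i ∧ i ≤ p ∧ P i ∧ i + 1 ∉ S) (hw : p ∈ S → w = true)
    (hw' : w' = true → P (p + 1) ∧ w = false) :
    ∃ S' : Finset ℕ, (∀ i ∈ S', 0 < i ∧ i ≤ p + 1 ∧ P i ∧ i + 1 ∉ S') ∧
      (p + 1 ∈ S' → w' = true) ∧ S'.card = S.card + w'.toNat ∧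
      (∀ i ∈ S', i ∈ S ∨ i = p + 1 ∧ w' = true) := by
  have hp : p + 1 ∉ S := fun h => by have := (hS _ h).2.1; omega
  cases w' with
  | false =>
    refine ⟨S, fun i hi => ?_, fun h => (hp h).elim, by simp, fun i hi => Or.inl hi⟩
    obtain ⟨h1, h2, h3⟩ := hS i hi
    exact ⟨h1, by omega, h3⟩
  | true =>
    obtain ⟨hP, hwf⟩ := hw' rfl
    have hpS : p ∉ S := fun h => by simp [hw h] at hwf
    refine ⟨insert (p + 1) S, fun i hi => ?_, fun _ => rfl, by simp [hp], fun i hi => ?_⟩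
    · rcases Finset.mem_insert.1 hi with rfl | hi
      · refine ⟨by omega, le_rfl, hP, fun h => ?_⟩
        rcases Finset.mem_insert.1 h with h | h
        · omega
        · have := (hS _ h).2.1; omega
      · obtain ⟨h1, h2, h3, h4⟩ := hS i hi
        refine ⟨h1, by omega, h3, fun h => ?_⟩
        rcases Finset.mem_insert.1 h with h | h
        · exact hpS (by rwa [← Nat.succ_injective h])
        · exact h4 h
    · rcases Finset.mem_insert.1 hi with rfl | hi
      · exact Or.inr ⟨rfl, rfl⟩
      · exact Or.inl hi

lemma Partial.step {a b : ℕ → Prop} {p : ℕ} {x y z : Bool} {f g : ℤ}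
    (h : Partial a b p x y z f g) (x' y' z' : Bool) {f' g' : ℤ}
    (hx' : x' = true → ¬ a (p + 1) ∧ x = false) (hy' : y' = true → ¬ b (p + 1) ∧ y = false)
    (hz' : z' = true → (¬ a (p + 1) ∧ ¬ b (p + 1)) ∧ z = false) (hxy : ¬ (x' = true ∧ y' = true))
    (hf' : f' ≤ f + 2 * x'.toNat + z'.toNat - 1) (hg' : g' ≤ g + 2 * y'.toNat + z'.toNat - 1) :
    Partial a b (p + 1) x' y' z' f' g' := by
  obtain ⟨C, D, E, hC, hD, hE, hCD, hx, hy, hz, hf, hg⟩ := h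
  obtain ⟨C', hC', hxC, hcC, hmC⟩ := exists_extend (P := fun i => ¬ a i) x' hC hx hx'
  obtain ⟨D', hD', hyD, hcD, hmD⟩ := exists_extend (P := fun i => ¬ b i) y' hD hy hy'
  obtain ⟨E', hE', hzE, hcE, -⟩ := exists_extend (P := fun i => ¬ a i ∧ ¬ b i) z'
    (fun i hi => let ⟨h1, h2, h3, h4, h5⟩ := hE i hi; ⟨h1, h2, ⟨h3, h4⟩, h5⟩) hz hz'
  refine ⟨C', D', E', hC', hD',
    fun i hi => let ⟨h1, h2, ⟨h3, h4⟩, h5⟩ := hE' i hi; ⟨h1, h2, h3, h4, h5⟩, ?_, hxC, hyD, hzE, ?_, ?_⟩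
  · rw [Finset.disjoint_left] at hCD ⊢
    intro i hi hi'
    rcases hmC i hi with h | ⟨h, h2⟩ <;> rcases hmD i hi' with h' | ⟨h', h2'⟩
    · exact hCD h h'
    · have := (hC _ h).2.1; omega
    · have := (hD _ h').2.1; omega
    · exact hxy ⟨h2, h2'⟩
  · rw [hcC, hcE]; push_cast; linarith
  · rw [hcD, hcE]; push_cast; linarith

/-! ### The invariant of the scan -/

/-- The partial solutions available at `p` when the last element of `a ∪ b` up to `p` lies in `a`
only: it is `p` itself, or at odd distance, or at positive even distance. -/
def AfterLeft (a b : ℕ → Prop) (p : ℕ) : Prop :=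
  (a p ∧ ¬ b p ∧ Partial a b p false true false 0 1) ∨
  (¬ a p ∧ ¬ b p ∧ Partial a b p true false true 2 1 ∧ Partial a b p false false true 0 1) ∨
  (¬ a p ∧ ¬ b p ∧ Partial a b p false true false 1 2 ∧ Partial a b p false false false 1 0)

/-- The partial solutions available at `p` when the last element of `a ∪ b` up to `p` lies in both:
it is `p` itself, or at odd distance, or at positive even distance. -/
def AfterBoth (a b : ℕ → Prop) (p : ℕ) (f g : ℤ) : Prop :=
  (a p ∧ b p ∧ Partial a b p false false false f g) ∨
  (¬ a p ∧ ¬ b p ∧ Partial a b p true false true (f + 2) g ∧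
    Partial a b p false true true f (g + 2)) ∨
  (¬ a p ∧ ¬ b p ∧ Partial a b p true false false (f + 1) (g + 1) ∧
    Partial a b p false true false (f + 1) (g + 1))

/-- The partial solutions available at `p` in general. -/
def Available (a b : ℕ → Prop) (p : ℕ) : Prop :=
  AfterLeft a b p ∨ AfterLeft b a p ∨ AfterBoth a b p 1 0 ∨ AfterBoth a b p 0 1 ∨
    (AfterBoth a b p 0 0 ∧ ∀ i, 0 < i → i ≤ p → ¬ a i ∧ ¬ b i)

lemma AfterBoth.swap {a b : ℕ → Prop} {p : ℕ} {f g : ℤ} (h : AfterBoth a b p f g) :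
    AfterBoth b a p g f := by
  rcases h with ⟨ha, hb, h⟩ | ⟨ha, hb, h, h'⟩ | ⟨ha, hb, h, h'⟩
  · exact Or.inl ⟨hb, ha, h.swap⟩
  · exact Or.inr (Or.inl ⟨hb, ha, h'.swap, h.swap⟩)
  · exact Or.inr (Or.inr ⟨hb, ha, h'.swap, h.swap⟩)

lemma Available.swap {a b : ℕ → Prop} {p : ℕ} (h : Available a b p) : Available b a p := by
  rcases h with h | h | h | h | ⟨h, h'⟩
  · exact Or.inr (Or.inl h)
  · exact Or.inl h
  · exact Or.inr (Or.inr (Or.inr (Or.inl h.swap)))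
  · exact Or.inr (Or.inr (Or.inl h.swap))
  · exact Or.inr (Or.inr (Or.inr (Or.inr ⟨h.swap, fun i h0 hi => (h' i h0 hi).symm⟩)))

/-- At positive distance, one stored alternative leaves `p` outside `C` and the other leaves it
outside `D`, so whichever set can use a coming unshared point is free to take it. -/
lemma AfterLeft.step {a b : ℕ → Prop} {p : ℕ} (h : AfterLeft a b p)
    (ha : ¬ (a p ∧ a (p + 1))) : Available a b (p + 1) := by
  by_cases a' : a (p + 1) <;> by_cases b' : b (p + 1)
  · rcases h with ⟨h1, -, -⟩ | ⟨-, -, h, -⟩ | ⟨-, -, h, -⟩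
    · exact (ha ⟨h1, a'⟩).elim
    · exact Or.inr (Or.inr (Or.inl (Or.inl ⟨a', b', h.step false false false
        (by simp) (by simp) (by simp) (by simp) (by simp) (by simp)⟩)))
    · exact Or.inr (Or.inr (Or.inr (Or.inl (Or.inl ⟨a', b', h.step false false false
        (by simp) (by simp) (by simp) (by simp) (by simp) (by simp)⟩))))
  · refine Or.inl (Or.inl ⟨a', b', ?_⟩)
    rcases h with ⟨h1, -, -⟩ | ⟨-, -, h, -⟩ | ⟨-, -, -, h⟩
    · exact (ha ⟨h1, a'⟩).elim
    · exact h.step false true false (by simp) (by simp [b']) (by simp) (by simp) (by simp) (by simp)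
    · exact h.step false true false (by simp) (by simp [b']) (by simp) (by simp) (by simp) (by simp)
  · refine Or.inr (Or.inl (Or.inl ⟨b', a', Partial.swap ?_⟩))
    rcases h with ⟨-, -, h⟩ | ⟨-, -, -, h⟩ | ⟨-, -, h, -⟩ <;>
    exact h.step true false false (by simp [a']) (by simp) (by simp) (by simp) (by simp) (by simp)
  · refine Or.inl (Or.inr ?_)
    rcases h with ⟨-, -, h⟩ | ⟨-, -, h, -⟩ | ⟨-, -, h, -⟩
    · exact Or.inl ⟨a', b', h.step true false true (by simp [a']) (by simp) (by simp [a', b'])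
        (by simp) (by simp) (by simp), h.step false false true (by simp) (by simp)
        (by simp [a', b']) (by simp) (by simp) (by simp)⟩
    · exact Or.inr ⟨a', b', h.step false true false (by simp) (by simp [b']) (by simp)
        (by simp) (by simp) (by simp), h.step false false false (by simp) (by simp)
        (by simp) (by simp) (by simp) (by simp)⟩
    · exact Or.inl ⟨a', b', h.step true false true (by simp [a']) (by simp) (by simp [a', b'])
        (by simp) (by simp) (by simp), h.step false false true (by simp) (by simp)
        (by simp [a', b']) (by simp) (by simp) (by simp)⟩

lemma AfterBoth.step_neither {a b : ℕ → Prop} {p : ℕ} {f g : ℤ} (h : AfterBoth a b p f g)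
    (a' : ¬ a (p + 1)) (b' : ¬ b (p + 1)) : AfterBoth a b (p + 1) f g := by
  refine Or.inr ?_
  rcases h with ⟨-, -, h⟩ | ⟨-, -, h, h'⟩ | ⟨-, -, h, h'⟩
  · exact Or.inl ⟨a', b', h.step true false true (by simp [a']) (by simp) (by simp [a', b'])
        (by simp) (by simp) (by simp), h.step false true true (by simp) (by simp [b'])
        (by simp [a', b']) (by simp) (by simp) (by simp)⟩
  · exact Or.inr ⟨a', b', h'.step true false false (by simp [a']) (by simp) (by simp)
        (by simp) (by simp) (by simp), h.step false true false (by simp)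
        (by simp [b']) (by simp) (by simp) (by simp) (by simp)⟩
  · exact Or.inl ⟨a', b', h'.step true false true (by simp [a']) (by simp) (by simp [a', b'])
        (by simp) (by simp) (by simp), h.step false true true (by simp) (by simp [b'])
        (by simp [a', b']) (by simp) (by simp) (by simp)⟩

lemma AfterBoth.step_left {a b : ℕ → Prop} {p : ℕ} {f g : ℤ} (h : AfterBoth a b p f g)
    (hf : 0 ≤ f) (hg : 0 ≤ g) (ha : ¬ (a p ∧ a (p + 1)))
    (a' : a (p + 1)) (b' : ¬ b (p + 1)) : AfterLeft a b (p + 1) := by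
  refine Or.inl ⟨a', b', ?_⟩
  rcases h with ⟨h1, -, -⟩ | ⟨-, -, h, -⟩ | ⟨-, -, h, -⟩
  · exact (ha ⟨h1, a'⟩).elim
  all_goals
    exact h.step false true false (by simp) (by simp [b']) (by simp) (by simp)
      (by simp; linarith) (by simp; linarith)

/-- After an odd gap, letting `D` take the last free position turns the balances `(1, 0)` into `(0,
1)`; after an even gap they stay `(1, 0)`. From `(0, 0)` a gap of one would leave a deficit. -/
lemma AfterBoth.step_both {a b : ℕ → Prop} {p : ℕ} (h : AfterBoth a b p 1 0)
    (ha : ¬ (a p ∧ a (p + 1))) (a' : a (p + 1)) (b' : b (p + 1)) : Available a b (p + 1) := by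
  rcases h with ⟨h1, -, -⟩ | ⟨-, -, -, h⟩ | ⟨-, -, h, -⟩
  · exact (ha ⟨h1, a'⟩).elim
  · exact Or.inr (Or.inr (Or.inr (Or.inl (Or.inl ⟨a', b', h.step false false false
      (by simp) (by simp) (by simp) (by simp) (by simp) (by simp)⟩))))
  · exact Or.inr (Or.inr (Or.inl (Or.inl ⟨a', b', h.step false false false
      (by simp) (by simp) (by simp) (by simp) (by simp) (by simp)⟩)))

lemma Available.step {a b : ℕ → Prop} {p : ℕ} (h : Available a b p)
    (ha : ¬ (a p ∧ a (p + 1))) (hb : ¬ (b p ∧ b (p + 1)))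
    (hfirst : (∀ i, 0 < i → i ≤ p → ¬ a i ∧ ¬ b i) → ¬ (a (p + 1) ∧ b (p + 1))) :
    Available a b (p + 1) := by
  rcases h with h | h | h
  · exact h.step ha
  · exact (h.step hb).swap
  by_cases a' : a (p + 1) <;> by_cases b' : b (p + 1)
  · rcases h with h | h | ⟨-, h'⟩
    · exact h.step_both ha a' b'
    · exact (h.swap.step_both hb b' a').swap
    · exact (hfirst h' ⟨a', b'⟩).elim
  · left
    rcases h with h | h | ⟨h, -⟩ <;> exact h.step_left (by simp) (by simp) ha a' b'
  · right; left
    rcases h with h | h | ⟨h, -⟩ <;> exact h.swap.step_left (by simp) (by simp) hb b' a'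
  · right; right
    rcases h with h | h | ⟨h, h'⟩
    · exact Or.inl (h.step_neither a' b')
    · exact Or.inr (Or.inl (h.step_neither a' b'))
    · refine Or.inr (Or.inr ⟨h.step_neither a' b', fun i h0 hi => ?_⟩)
      rcases Nat.lt_or_ge p i with hi' | hi'
      · obtain rfl : i = p + 1 := by omega
        exact ⟨a', b'⟩
      · exact h' i h0 hi'

lemma exists_partial {a b : ℕ → Prop} {n : ℕ} (ha : ∀ i < n, ¬ (a i ∧ a (i + 1)))
    (hb : ∀ i < n, ¬ (b i ∧ b (i + 1))) (hn : 0 < n) (ha0 : a 0) (hb0 : b 0) (han : a n)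
    (hbn : b n)
    (hfirst : ∀ q, 0 < q → q ≤ n → (∀ i, 0 < i → i < q → ¬ a i ∧ ¬ b i) → ¬ (a q ∧ b q)) :
    Partial a b n false false false 0 0 := by
  have key : ∀ p ≤ n, Available a b p := by
    intro p
    induction p with
    | zero =>
      exact fun _ => Or.inr (Or.inr (Or.inr (Or.inr ⟨Or.inl ⟨ha0, hb0, Partial.zero a b⟩,
        fun i h0 hi => by omega⟩)))
    | succ p ih =>
      intro hp
      exact (ih (by omega)).step (ha p (by omega)) (hb p (by omega)) fun h =>
        hfirst (p + 1) (by omega) hp fun i h0 hi => h i h0 (by omega)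
  have both : ∀ f g : ℤ, 0 ≤ f → 0 ≤ g → AfterBoth a b n f g →
      Partial a b n false false false 0 0 := by
    intro f g hf hg h
    rcases h with ⟨-, -, C, D, E, h1, h2, h3, h4, h5, h6, h7, h8, h9⟩ | ⟨h, -⟩ | ⟨h, -⟩
    · exact ⟨C, D, E, h1, h2, h3, h4, h5, h6, h7, hf.trans h8, hg.trans h9⟩
    all_goals exact (h han).elim
  rcases key n le_rfl with h | h | h | h | ⟨-, h⟩
  · rcases h with ⟨-, h, -⟩ | ⟨-, h, -⟩ | ⟨-, h, -⟩ <;> exact (h hbn).elim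
  · rcases h with ⟨-, h, -⟩ | ⟨-, h, -⟩ | ⟨-, h, -⟩ <;> exact (h han).elim
  · exact both _ _ (by simp) (by simp) h
  · exact both _ _ (by simp) (by simp) h
  · exact ((h n hn le_rfl).1 han).elim

/-! ### Between positions and points of the cycle -/

/-- The point of `{1, …, n}` reached from `x` by `j ≤ n` steps around the cycle. -/
def cycleShift (n x j : ℕ) : ℕ := if x + j ≤ n then x + j else x + j - n

lemma cycleShift_injOn {n x : ℕ} {S : Finset ℕ} (hS : ∀ i ∈ S, 0 < i ∧ i < n) :
    Set.InjOn (cycleShift n x) S := by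
  intro i hi j hj h
  have h1 := hS i hi
  have h2 := hS j hj
  unfold cycleShift at h
  split_ifs at h <;> omega

lemma not_mem_consecutive {n x : ℕ} {A : Finset ℕ} (hn : 2 ≤ n) (hA : IsStable 2 n A)
    (i : ℕ) :
    ¬ (cycleShift n x i ∈ A ∧ cycleShift n x (i + 1) ∈ A) := by
  rintro ⟨h1, h2⟩
  have hne : cycleShift n x i ≠ cycleShift n x (i + 1) := by
    unfold cycleShift; split_ifs <;> omega
  obtain ⟨h3, h4⟩ := hA _ h1 _ h2 hne
  unfold cycleShift at h3 h4
  rw [le_abs] at h3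
  rw [abs_le] at h4
  split_ifs at h3 h4 <;> omega

/-- Excluding position `n`, the cut point itself, rules out a conflict with position 1 across the
cut. -/
lemma isStable_image_cycleShift {n x : ℕ} {S : Finset ℕ}
    (hS : ∀ i ∈ S, 0 < i ∧ i < n ∧ i + 1 ∉ S) :
    IsStable 2 n (S.image (cycleShift n x)) := by
  intro u hu v hv huv
  obtain ⟨i, hi, rfl⟩ := Finset.mem_image.1 hu
  obtain ⟨j, hj, rfl⟩ := Finset.mem_image.1 hv
  obtain ⟨hi0, hin, hi1⟩ := hS i hi
  obtain ⟨hj0, hjn, hj1⟩ := hS j hj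
  have h0 : i ≠ j := fun h => huv (by rw [h])
  have h1 : i + 1 ≠ j := fun h => hi1 (h ▸ hj)
  have h2 : j + 1 ≠ i := fun h => hj1 (h ▸ hi)
  rw [le_abs, abs_le]
  unfold cycleShift
  split_ifs <;> omega

lemma IsStable.mono {s n : ℕ} {S T : Finset ℕ} (hT : IsStable s n T) (h : S ⊆ T) :
    IsStable s n S :=
  fun i hi j hj => hT i (h hi) j (h hj)

/-- A vertex of the Schrijver graph from a sufficiently large set of positions, counted from `x`,
without consecutive elements. -/
lemma exists_vertex {n k x : ℕ} (hx : x ∈ Finset.Icc 1 n) {S : Finset ℕ}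
    (hS : ∀ i ∈ S, 0 < i ∧ i < n ∧ i + 1 ∉ S) (hk : k ≤ S.card) :
    ∃ V : {S : KneserVertex n k | IsStable 2 n S.1}, V.1.1 ⊆ S.image (cycleShift n x) := by
  have hc : (S.image (cycleShift n x)).card = S.card :=
    Finset.card_image_of_injOn (cycleShift_injOn fun i hi => ⟨(hS i hi).1, (hS i hi).2.1⟩)
  obtain ⟨T, hT, hTk⟩ := Finset.exists_subset_card_eq (hc ▸ hk)
  refine ⟨⟨⟨T, fun u hu => ?_, hTk⟩, (isStable_image_cycleShift hS).mono hT⟩, hT⟩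
  obtain ⟨i, hi, rfl⟩ := Finset.mem_image.1 (hT hu)
  obtain ⟨hi0, hin, -⟩ := hS i hi
  rw [Finset.mem_Icc] at hx ⊢
  unfold cycleShift
  split_ifs <;> omega

lemma schrijverGraph_adj {n k : ℕ} (hk : 0 < k)
    {A B : {S : KneserVertex n k | IsStable 2 n S.1}} :
    (schrijverGraph n k).Adj A B ↔ Disjoint A.1.1 B.1.1 := by
  refine ⟨fun h => h.2, fun h => ⟨fun hAB => ?_, h⟩⟩
  change A.1 = B.1 at hAB
  rw [hAB, disjoint_self, Finset.bot_eq_empty] at h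
  have := B.1.2.2
  rw [h, Finset.card_empty] at this
  omega

/-! ### Upper bound -/

/-- Two distinct intersecting sets of equal size share a point such that the next point of their
union around the cycle is not shared. -/
lemma exists_start {n : ℕ} {A B : Finset ℕ} (hA : A ⊆ Finset.Icc 1 n) (hc : B.card = A.card)
    (hAB : A ≠ B) (hd : ¬ Disjoint A B) :
    ∃ x ∈ A ∩ B, ∀ q, 0 < q → q ≤ n →
      (∀ i, 0 < i → i < q → cycleShift n x i ∉ A ∧ cycleShift n x i ∉ B) →
      ¬ (cycleShift n x q ∈ A ∧ cycleShift n x q ∈ B) := by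
  obtain ⟨y, hyA, hyB⟩ : ∃ y ∈ A, y ∉ B := by
    by_contra! h
    exact hAB (Finset.eq_of_subset_of_card_le h hc.le)
  have hne : (A ∩ B).Nonempty := by
    rwa [Finset.nonempty_iff_ne_empty, Ne, ← Finset.disjoint_iff_inter_eq_empty]
  -- Take the shared point nearest before `y`, measured forward around the cycle. If the next point
  -- of the union were shared, it would come before `y` and be nearer.
  obtain ⟨x, hx, hmin⟩ := Finset.exists_min_image (A ∩ B)
    (fun x => if x < y then y - x else y + n - x) hne
  refine ⟨x, hx, fun q hq hqn hfree hqAB => ?_⟩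
  have hy := Finset.mem_Icc.1 (hA hyA)
  have hx' := Finset.mem_Icc.1 (hA (Finset.mem_inter.1 hx).1)
  have hxy : x ≠ y := fun h => hyB (h ▸ (Finset.mem_inter.1 hx).2)
  have hm := hmin _ (Finset.mem_inter.2 hqAB)
  have hqy : cycleShift n x q ≠ y := fun h => hyB (h ▸ hqAB.2)
  have hfy : ∀ i, 0 < i → i < q → cycleShift n x i ≠ y :=
    fun i h0 hi h => (hfree i h0 hi).1 (h ▸ hyA)
  have hd0 : cycleShift n x (if x < y then y - x else y + n - x) = y := by
    unfold cycleShift; split_ifs <;> omega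
  have hdq : q < if x < y then y - x else y + n - x := by
    by_contra! h
    rcases h.lt_or_eq with h | h
    · exact hfy _ (by split_ifs <;> omega) h hd0
    · exact hqy (h ▸ hd0)
  unfold cycleShift at hm hqy
  split_ifs at hm hdq hqy <;> omega

lemma exists_walk_length_le_three {n k r : ℕ} (hn : n = 2 * k + r) (hk : 0 < k)
    (hr : k ≤ r + 2) (A B : {S : KneserVertex n k | IsStable 2 n S.1}) :
    ∃ p : (schrijverGraph n k).Walk A B, p.length ≤ 3 := by
  by_cases hAB : A = B
  · subst hAB
    exact ⟨.nil, by simp⟩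
  by_cases hd : Disjoint A.1.1 B.1.1
  · exact ⟨.cons ((schrijverGraph_adj hk).2 hd) .nil, by simp⟩
  obtain ⟨x, hx, hfirst⟩ := exists_start A.1.2.1 (B.1.2.2.trans A.1.2.2.symm)
    (fun h => hAB (Subtype.ext (Subtype.ext h))) hd
  rw [Finset.mem_inter] at hx
  have hxI := A.1.2.1 hx.1
  have hx1 := Finset.mem_Icc.1 hxI
  have h0 : cycleShift n x 0 = x := by unfold cycleShift; split_ifs <;> omega
  have h1 : cycleShift n x n = x := by unfold cycleShift; split_ifs <;> omega
  obtain ⟨C, D, E, hC, hD, hE, hCD, hnC, hnD, hnE, hc, hd⟩ :=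
    exists_partial (a := fun i => cycleShift n x i ∈ A.1.1) (b := fun i => cycleShift n x i ∈ B.1.1)
      (n := n) (fun i _ => not_mem_consecutive (by omega) A.2 i)
      (fun i _ => not_mem_consecutive (by omega) B.2 i) (by omega)
      (h0.symm ▸ hx.1) (h0.symm ▸ hx.2) (h1.symm ▸ hx.1) (h1.symm ▸ hx.2) hfirst
  have lt : ∀ {S : Finset ℕ}, (n ∈ S → false = true) → ∀ i ∈ S, i ≤ n → i < n :=
    fun hS i hi h => h.lt_of_ne fun h' => by simpa using hS (h' ▸ hi)
  have hC' : ∀ i ∈ C, 0 < i ∧ i < n ∧ i + 1 ∉ C :=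
    fun i hi => ⟨(hC i hi).1, lt hnC i hi (hC i hi).2.1, (hC i hi).2.2.2⟩
  have hD' : ∀ i ∈ D, 0 < i ∧ i < n ∧ i + 1 ∉ D :=
    fun i hi => ⟨(hD i hi).1, lt hnD i hi (hD i hi).2.1, (hD i hi).2.2.2⟩
  have hE' : ∀ i ∈ E, 0 < i ∧ i < n ∧ i + 1 ∉ E :=
    fun i hi => ⟨(hE i hi).1, lt hnE i hi (hE i hi).2.1, (hE i hi).2.2.2.2⟩
  have disj : ∀ {S : Finset ℕ} {U V : Finset ℕ}, U ⊆ S.image (cycleShift n x) →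
      (∀ i ∈ S, cycleShift n x i ∉ V) → Disjoint U V := by
    intro S U V hU hS
    rw [Finset.disjoint_left]
    intro u hu
    obtain ⟨i, hi, rfl⟩ := Finset.mem_image.1 (hU hu)
    exact hS i hi
  by_cases he : k ≤ E.card
  · obtain ⟨V, hV⟩ := exists_vertex hxI hE' he
    exact ⟨.cons ((schrijverGraph_adj hk).2 (disj hV fun i hi => (hE i hi).2.2.1).symm)
      (.cons ((schrijverGraph_adj hk).2 (disj hV fun i hi => (hE i hi).2.2.2.1)) .nil), by simp⟩
  -- Here `2|C| ≥ n - (k - 1) = k + r + 1 ≥ 2k - 1`, so `|C| ≥ k`; likewise for `D`.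
  · obtain ⟨V, hV⟩ := exists_vertex (k := k) hxI hC' (by omega)
    obtain ⟨W, hW⟩ := exists_vertex (k := k) hxI hD' (by omega)
    have hVW : Disjoint V.1.1 W.1.1 := by
      refine disj hV fun i hi hiW => ?_
      obtain ⟨j, hj, hij⟩ := Finset.mem_image.1 (hW hiW)
      have hinj := cycleShift_injOn (n := n) (x := x) (S := C ∪ D) fun l hl => by
        rcases Finset.mem_union.1 hl with h | h
        · exact ⟨(hC' l h).1, (hC' l h).2.1⟩
        · exact ⟨(hD' l h).1, (hD' l h).2.1⟩
      have := hinj (Finset.mem_coe.2 (Finset.mem_union_right C hj))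
        (Finset.mem_coe.2 (Finset.mem_union_left D hi)) hij
      exact Finset.disjoint_left.1 hCD hi (this ▸ hj)
    exact ⟨.cons ((schrijverGraph_adj hk).2 (disj hV fun i hi => (hC i hi).2.2.1).symm)
      (.cons ((schrijverGraph_adj hk).2 hVW)
      (.cons ((schrijverGraph_adj hk).2 (disj hW fun i hi => (hD i hi).2.2.1)) .nil)), by simp⟩

/-! ### Lower bound -/

/-- Two intersecting vertices without a common neighbour. -/
lemma exists_pair_without_common_neighbor {n k r : ℕ} (hn : n = 2 * k + r) (hk : 2 < k)
    (hr₁ : k ≤ r + 2) (hr₂ : r + 3 ≤ 2 * k) :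
    ∃ A B : {S : KneserVertex n k | IsStable 2 n S.1}, A ≠ B ∧ ¬ Disjoint A.1.1 B.1.1 ∧
      ∀ V : {S : KneserVertex n k | IsStable 2 n S.1},
        Disjoint A.1.1 V.1.1 → ¬ Disjoint V.1.1 B.1.1 := by
  rcases Nat.lt_or_ge r 2 with hr | hr
  -- The general pair fails for `r = 1`, where `2k + 1 = n` is next to 1; only `n = 7`, `k = 3`
  -- remains.
  · obtain rfl : k = 3 := by omega
    obtain rfl : r = 1 := by omega
    subst hn
    refine ⟨⟨⟨{1, 3, 5}, by decide, rfl⟩, ?_⟩, ⟨⟨{1, 4, 6}, by decide, rfl⟩, ?_⟩, ?_, ?_, ?_⟩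
    · change ∀ i ∈ _, ∀ j ∈ _, _
      decide
    · change ∀ i ∈ _, ∀ j ∈ _, _
      decide
    · intro h
      have := congrArg (fun S => S.1.1) h
      revert this
      decide
    · change ¬ Disjoint ({1, 3, 5} : Finset ℕ) {1, 4, 6}
      decide
    · intro V h1 h2
      have hsub : V.1.1 ⊆ {2, 7} := by
        intro v hv
        have h3 := Finset.mem_Icc.1 (V.1.2.1 hv)
        have h4 := Finset.disjoint_right.1 h1 hv
        have h5 := Finset.disjoint_left.1 h2 hv
        simp only [Finset.mem_insert, Finset.mem_singleton] at h4 h5 ⊢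
        omega
      have h3 := Finset.card_le_card hsub
      rw [V.1.2.2] at h3
      revert h3
      decide
  -- The pair is `{1, 3, …, 2k-3}` and `{2, 4, …, 2k-2}`, each with `2k + 1` added.
  · have hcard : ∀ f : ℕ → ℕ, (∀ i, f i = 2 * i + f 0) → f 0 < 3 →
        (insert (2 * k + 1) ((Finset.range (k - 1)).image f)).card = k := by
      intro f hf hf0
      rw [Finset.card_insert_of_notMem, Finset.card_image_of_injective, Finset.card_range]
      · omega
      · intro i j h
        rw [hf i, hf j] at h
        omega
      · intro h
        obtain ⟨i, hi, h⟩ := Finset.mem_image.1 h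
        rw [Finset.mem_range] at hi
        rw [hf i] at h
        omega
    have hmem : ∀ c v, v ∈ insert (2 * k + 1) ((Finset.range (k - 1)).image (2 * · + c)) ↔
        v = 2 * k + 1 ∨ ∃ i, i < k - 1 ∧ 2 * i + c = v := by
      simp
    have hstable : ∀ c, 1 ≤ c → c < 3 →
        IsStable 2 n (insert (2 * k + 1) ((Finset.range (k - 1)).image (2 * · + c))) := by
      intro c hc hc' u hu v hv huv
      rw [hmem] at hu hv
      rw [le_abs, abs_le]
      rcases hu with rfl | ⟨i, hi, rfl⟩ <;> rcases hv with rfl | ⟨j, hj, rfl⟩ <;> omega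
    have hsub : ∀ c, 1 ≤ c → c < 3 →
        insert (2 * k + 1) ((Finset.range (k - 1)).image (2 * · + c)) ⊆ Finset.Icc 1 n := by
      intro c hc hc' v hv
      rw [hmem] at hv
      rw [Finset.mem_Icc]
      rcases hv with rfl | ⟨i, hi, rfl⟩ <;> omega
    refine ⟨⟨⟨_, hsub 1 le_rfl (by simp), hcard _ (by simp) (by simp)⟩,
      hstable 1 le_rfl (by simp)⟩, ⟨⟨_, hsub 2 (by simp) (by simp), hcard _ (by simp) (by simp)⟩,
      hstable 2 (by simp) (by simp)⟩, ?_, ?_, ?_⟩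
    · intro h
      have h1 := congrArg (fun S => 1 ∈ S.1.1) h
      simp only [hmem, eq_iff_iff] at h1
      obtain h2 | ⟨i, hi, h2⟩ := h1.1 (Or.inr ⟨0, by omega, rfl⟩) <;> omega
    · exact Finset.not_disjoint_iff.2
        ⟨2 * k + 1, Finset.mem_insert_self _ _, Finset.mem_insert_self _ _⟩
    · intro V h1 h2
      have hV : ∀ v ∈ V.1.1, v ≤ n ∧ 2 * k - 1 ≤ v ∧ v ≠ 2 * k + 1 := by
        intro v hv
        have h3 := Finset.mem_Icc.1 (V.1.2.1 hv)
        have h4 := Finset.disjoint_right.1 h1 hv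
        have h5 := Finset.disjoint_left.1 h2 hv
        rw [hmem] at h4 h5
        refine ⟨h3.2, ?_, fun h => h4 (Or.inl h)⟩
        by_contra! h
        rcases Nat.even_or_odd' v with ⟨i, rfl | rfl⟩
        · exact h5 (Or.inr ⟨i - 1, by omega, by omega⟩)
        · exact h4 (Or.inr ⟨i, by omega, rfl⟩)
      have hle : V.1.1.card ≤ (Finset.range (k - 1)).card := by
        -- The classes are the pairs `{2k-1, 2k}`, `{2k+2, 2k+3}`, …, truncated subtraction sending
        -- `2k - 1` to 0. A stable set meets each at most once, and `n ≤ 4k - 3` leaves at most `k -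
        -- 1` classes.
        refine Finset.card_le_card_of_injOn (fun v => (v - 2 * k) / 2) (fun v hv => ?_) ?_
        · have := hV v hv
          simp only [Finset.coe_range, Set.mem_Iio]
          omega
        · intro u hu v hv huv
          by_contra hne
          have h3 := hV u hu
          have h4 := hV v hv
          have h5 := (V.2 u hu v hv hne).1
          rw [le_abs] at h5
          simp only at huv
          push_cast at h5
          omega
      rw [V.1.2.2, Finset.card_range] at hle
      omega

theorem mainTheorem2 (n k r : ℕ) (hn : n = 2 * k + r) (hk : 2 < k)
    (hr₁ : k ≤ r + 2) (hr₂ : r + 3 ≤ 2 * k) :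
    (schrijverGraph n k).Connected ∧ (schrijverGraph n k).diam = 3 := by
  have hk0 : 0 < k := by omega
  obtain ⟨A, B, hAB, hd, hno⟩ := exists_pair_without_common_neighbor hn hk hr₁ hr₂
  have walk := exists_walk_length_le_three hn hk0 hr₁
  have hconn : (schrijverGraph n k).Connected :=
    { preconnected := fun u v => (walk u v).choose.reachable
      nonempty := ⟨A⟩ }
  have hle : (schrijverGraph n k).ediam ≤ (3 : ℕ) :=
    SimpleGraph.ediam_le_of_edist_le fun u v => by
      obtain ⟨p, hp⟩ := walk u v
      exact p.edist_le.trans (by exact_mod_cast hp)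
  have htop : (schrijverGraph n k).ediam ≠ ⊤ := ne_top_of_le_ne_top (ENat.natCast_ne_top 3) hle
  refine ⟨hconn, le_antisymm (ENat.toNat_le_of_le_natCast hle) ?_⟩
  refine le_trans ?_ (SimpleGraph.dist_le_diam htop (u := A) (v := B))
  obtain ⟨p, hp⟩ := hconn.exists_walk_length_eq_dist A B
  rw [← hp]
  match p with
  | .nil => exact (hAB rfl).elim
  | .cons h .nil => exact (hd ((schrijverGraph_adj hk0).1 h)).elim
  | .cons h (.cons h' .nil) =>
    exact (hno _ ((schrijverGraph_adj hk0).1 h) ((schrijverGraph_adj hk0).1 h')).elim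
  | .cons _ (.cons _ (.cons _ q)) => simp
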